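/- Let $\mu=(1+x)\,dy$ on $\mathbb{R}^2$ with coordinates $(x,y)$. Let $X$ be the germ at the origin of a $C^\infty$ vector field on $\mathbb{R}^2$ preserving $\mu$, i.e. $\mathcal{L}_X\mu=0$. Two such germs $X,Y$ are called $\mu$-conjugate if there is a germ $\phi$ at the origin of a $C^\infty$ diffeomorphism of $\mathbb{R}^2$ with $\phi(0)=0$, $\phi^*\mu=\mu$ and $\phi_*Y=X$. A hyperbolic singularity is a zero of the vector field at which no complex eigenvalue of the linearization has zero real part. Write $j^iX(0)$ for the $i$-jet of $X$ at the origin, so $j^iX(0)=0$ means that all partial derivatives of $X$ of order at most $i$ vanish at the origin. Then: (i) $X$ has no hyperbolic singularities, i.e. there is a neighbourhood of the origin containing no hyperbolic singularity of $X$ (in particular the origin is not one). (ii) If $X(0)\neq 0$, then exactly one of the following holds: $X$ is $\mu$-conjugate to $X_0=a\,\frac{\partial}{\partial y}$ for some real $a\neq0$; or $X$ is $\mu$-conjugate to $X_1=-a(1+x)\frac{\partial}{\partial x}+ay\,\frac{\partial}{\partial y}$ for some real $a\neq 0$. (iii) If $k\ge 2$ is an integer with $j^iX(0)=0$ for $i=0,\dots,k-2$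 and $j^{k-1}X(0)\neq0$, then there are real numbers $a\neq 0$ and $d$ such that $X$ is $\mu$-conjugate to $$X_k=-(1+x)\bigl(ak\,y^{k-1}+d(2k-1)\,y^{2k-2}\bigr)\frac{\partial}{\partial x}+\bigl(a\,y^k+d\,y^{2k-1}\bigr)\frac{\partial}{\partial y}.$$ -/

import Mathlib

open Filter Topology
open scoped ContDiff Manifold

namespace Martinet

/-- The plane with coordinates `(x, y)`. Germs at the origin are given by representatives
defined on the whole plane; every notion below only depends on the germ at the origin. -/
abbrev Plane : Type := ℝ × ℝ

/-- The `1`-form `μ = (1 + x) dy`. -/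
noncomputable def mu (p : Plane) : Plane →L[ℝ] ℝ :=
  (1 + p.1) • ContinuousLinearMap.snd ℝ ℝ ℝ

/-- The Lie derivative of a `1`-form along a vector field:
`(L_X η)_p (v) = (D_{X p} η) (v) + η_p (DX_p v)`,
that is, `(L_X η)_j = ∑ i, (X_i ∂_i η_j + η_i ∂_j X_i)` in coordinates. -/
noncomputable def lieDerivative (X : Plane → Plane) (η : Plane → Plane →L[ℝ] ℝ) (p : Plane) :
    Plane →L[ℝ] ℝ :=
  fderiv ℝ η p (X p) + (η p).comp (fderiv ℝ X p)

/-- The pull-back `φ^* η` of a `1`-form: `(φ^* η)_p (v) = η_{φ p} (Dφ_p v)`. -/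
noncomputable def pullback (φ : Plane → Plane) (η : Plane → Plane →L[ℝ] ℝ) (p : Plane) :
    Plane →L[ℝ] ℝ :=
  (η (φ p)).comp (fderiv ℝ φ p)

/-- The germ at the origin of `X` is a `C^∞` vector field with `L_X μ = 0`. -/
structure PreservesMu (X : Plane → Plane) : Prop where
  /-- `X` is `C^∞` on a neighbourhood of the origin. -/
  smooth : ∀ᶠ p in 𝓝 (0 : Plane), ContDiffAt ℝ ∞ X p
  /-- `L_X μ = 0` on a neighbourhood of the origin. -/
  lie_eq_zero : ∀ᶠ p in 𝓝 (0 : Plane), lieDerivative X mu p = 0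

/-- The germ at the origin of `φ` is a `C^∞` diffeomorphism fixing the origin, with
`φ^* μ = μ`. -/
structure IsMuDiffeo (φ : Plane → Plane) : Prop where
  map_zero : φ 0 = 0
  diffeo : IsLocalDiffeomorphAt 𝓘(ℝ, Plane) 𝓘(ℝ, Plane) ∞ φ 0
  pullback_eq : ∀ᶠ p in 𝓝 (0 : Plane), pullback φ mu p = mu p

/-- `X` and `Y` are `μ`-conjugate: `φ_* Y = X`, that is, `Dφ · Y = X ∘ φ` near the origin, for the
germ of some diffeomorphism `φ` preserving `μ`. -/
def MuConjugate (X Y : Plane → Plane) : Prop :=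
  ∃ φ : Plane → Plane, IsMuDiffeo φ ∧ ∀ᶠ p in 𝓝 (0 : Plane), fderiv ℝ φ p (Y p) = X (φ p)

/-- `p` is a hyperbolic singularity of `X`: `X p = 0` and no (complex) eigenvalue of the
linearization of `X` at `p` has zero real part. -/
def IsHyperbolicSingularity (X : Plane → Plane) (p : Plane) : Prop :=
  X p = 0 ∧ ∀ z : ℂ,
    Module.End.HasEigenvalue
      (LinearMap.baseChange ℂ ((fderiv ℝ X p : Plane →L[ℝ] Plane) : Plane →ₗ[ℝ] Plane)) z →
    z.re ≠ 0

/-- `j^i X (0) = 0`: all partial derivatives of `X` at the origin of order at most `i` vanish. -/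
def JetVanishes (i : ℕ) (X : Plane → Plane) : Prop :=
  ∀ m : ℕ, m ≤ i → iteratedFDeriv ℝ m X 0 = 0

/-- `X_0 = a ∂_y`. -/
def modelZero (a : ℝ) : Plane → Plane := fun _ => (0, a)

/-- `X_1 = -a (1 + x) ∂_x + a y ∂_y`. -/
def modelOne (a : ℝ) : Plane → Plane := fun p => (-a * (1 + p.1), a * p.2)

/-- `X_k = -(1 + x) (a k y^(k-1) + d (2k-1) y^(2k-2)) ∂_x + (a y^k + d y^(2k-1)) ∂_y`,
used for `k ≥ 2`. -/
def modelDegenerate (k : ℕ) (a d : ℝ) : Plane → Plane := fun p =>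
  (-(1 + p.1) * (a * (k : ℝ) * p.2 ^ (k - 1) + d * (2 * (k : ℝ) - 1) * p.2 ^ (2 * k - 2)),
    a * p.2 ^ k + d * p.2 ^ (2 * k - 1))

end Martinet

/-!
In coordinates, `L_X μ = 0` says that `X` is a *suspension*
`-(1 + x) b'(y) ∂_x + b(y) ∂_y` of a vector field `b ∂_y` on the line
(`PreservesMu.exists_eventuallyEq_suspension`), and a germ `q` on the line with `q 0 = 0` and
`q' 0 = 1` suspends to the `μ`-preserving germ `(x, y) ↦ ((1 + x) / q'(y) - 1, q(y))`. A conjugacy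
`q' * m = b ∘ q` on the line lifts to the suspensions (`TangentConjugate.muConjugate`), so the
normal forms reduce to the classification of vector fields on the line up to diffeomorphisms
tangent to the identity.

On the line all cases are treated together. Let `m = y ^ k / p` and `b = y ^ k / n` with `p`, `n`
smooth and nonzero at `0`. A conjugacy `q` has to preserve the time form,
`dq / b(q) = dy / m(y)`. Writing `q y = y * w y`, the time from `y` to `y * w` along `b` is
`y ^ (1 - k) * G (y, w)` with `G (y, w) = ∫ s in 1..w, n (y s) / s ^ k`, smooth near `(0, 1)`,
and the equation becomes `G (y, w y) = S y`, where `S` solves the Euler equation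
`y S' - (k - 1) S = p - n`. Since `∂G/∂w = n 0 ≠ 0` at `(0, 1)`, the inverse function theorem gives
`w` (`tangentConjugate_of_euler_solution`). For `k ≥ 1` and `p 0 = n 0`, a smooth `S` with `S 0 = 0`
exists if `p` and `n` have the same coefficient of `y ^ (k - 1)` (`exists_euler_solution`, by
induction through Hadamard's lemma); matching this residue is the role of the parameter `d`.
For `k = 0` there is no obstruction.

A singularity of a suspension near the origin has `b = b' = 0`, so `∂_x` is in the kernel of the
linearization, and the singularity is not hyperbolic. The two cases for `X 0 ≠ 0` exclude each
other because `b 0` is invariant under `μ`-conjugacy.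
-/

namespace Martinet

/-! ### Smooth functions of one real variable -/

lemma exists_contDiff_eventuallyEq {f : ℝ → ℝ} {a : ℝ}
    (hf : ∀ᶠ y in 𝓝 a, ContDiffAt ℝ ∞ f y) :
    ∃ g : ℝ → ℝ, ContDiff ℝ ∞ g ∧ g =ᶠ[𝓝 a] f := by
  obtain ⟨ε, hε, h⟩ := Metric.eventually_nhds_iff_ball.1 hf
  let χ : ContDiffBump a := ⟨ε / 4, ε / 2, by positivity, by linarith⟩
  refine ⟨fun y => χ y * f y, contDiff_iff_contDiffAt.2 fun y => ?_, ?_⟩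
  · by_cases hy : y ∈ Metric.ball a ε
    · exact χ.contDiffAt.mul (h y hy)
    · have hy' : y ∉ tsupport χ := by
        rw [χ.tsupport_eq]
        intro h'
        refine hy (Metric.closedBall_subset_ball ?_ h')
        change ε / 2 < ε
        linarith
      refine contDiffAt_const (c := (0 : ℝ)) |>.congr_of_eventuallyEq ?_
      filter_upwards [notMem_tsupport_iff_eventuallyEq.1 hy'] with z hz
      simp [hz]
  · filter_upwards [χ.eventuallyEq_one] with y hy
    simp [hy]

/-- An integral over a compact interval of a smooth function depends smoothly on a parameter.
It is the value at `0` of the convolution of the indicator function of the interval with the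
reflected integrand, cut off outside a neighbourhood of the interval. -/
lemma contDiff_parametric_integral {P : Type*} [NormedAddCommGroup P] [NormedSpace ℝ P]
    {F : P × ℝ → ℝ} (hF : ContDiff ℝ ∞ F) :
    ContDiff ℝ ∞ fun p => ∫ t in (0 : ℝ)..1, F (p, t) := by
  let χ : ContDiffBump (0 : ℝ) := ⟨2, 3, by norm_num, by norm_num⟩
  let ind : ℝ → ℝ := (Set.Ioc (0 : ℝ) 1).indicator fun _ => 1
  let g : P → ℝ → ℝ := fun p x => χ x * F (p, -x)
  have hind : MeasureTheory.LocallyIntegrable ind MeasureTheory.volume := by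
    apply MeasureTheory.Integrable.locallyIntegrable
    rw [MeasureTheory.integrable_indicator_iff measurableSet_Ioc]
    simp
  have hg : ContDiffOn ℝ ((⊤ : ℕ∞) : WithTop ℕ∞) ↿g (Set.univ ×ˢ Set.univ) := by
    refine ContDiff.contDiffOn ?_
    change ContDiff ℝ ∞ fun q : P × ℝ => χ q.2 * F (q.1, -q.2)
    exact (χ.contDiff.comp contDiff_snd).mul (hF.comp (contDiff_fst.prodMk contDiff_snd.neg))
  have key := MeasureTheory.contDiffOn_convolution_right_with_param_comp (μ := MeasureTheory.volume)
    (ContinuousLinearMap.mul ℝ ℝ) (v := fun _ : P => (0 : ℝ)) contDiffOn_const isOpen_univ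
    (isCompact_closedBall (0 : ℝ) 3) (fun p x _ hx => ?_) hind hg
  · rw [contDiffOn_univ] at key
    convert! key using 2 with p
    rw [MeasureTheory.convolution_def, intervalIntegral.integral_of_le zero_le_one,
      ← MeasureTheory.integral_indicator measurableSet_Ioc]
    congr 1
    ext t
    by_cases ht : t ∈ Set.Ioc (0 : ℝ) 1
    · have h1 : χ (0 - t) = 1 := by
        apply χ.one_of_mem_closedBall
        change _ ∈ Metric.closedBall (0 : ℝ) 2
        rw [mem_closedBall_zero_iff, Real.norm_eq_abs, abs_le]
        constructor <;> linarith [ht.1, ht.2]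
      simp only [ind, g, Set.indicator_of_mem ht, ContinuousLinearMap.mul_apply', h1]
      simp
    · simp [ind, Set.indicator_of_notMem ht]
  · have : χ x = 0 := by
      apply χ.zero_of_le_dist
      change 3 ≤ _
      rw [Metric.mem_closedBall, not_le] at hx
      exact hx.le
    simp [g, this]

lemma exists_antideriv {f : ℝ → ℝ} (hf : ContDiff ℝ ∞ f) :
    ∃ g : ℝ → ℝ, ContDiff ℝ ∞ g ∧ g 0 = 0 ∧ ∀ y, HasDerivAt g (f y) y := by
  have h : ∀ y, HasDerivAt (fun y => ∫ t in (0 : ℝ)..y, f t) (f y) y := fun y =>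
    hf.continuous.integral_hasStrictDerivAt 0 y |>.hasDerivAt
  refine ⟨_, contDiff_infty_iff_deriv.2 ⟨fun y => (h y).differentiableAt, ?_⟩, by simp, h⟩
  rwa [funext fun y => (h y).deriv]

/-- Hadamard's lemma in one variable. -/
lemma exists_eq_id_mul {f : ℝ → ℝ} (hf : ContDiff ℝ ∞ f) (h0 : f 0 = 0) :
    ∃ g : ℝ → ℝ, ContDiff ℝ ∞ g ∧ ∀ y, f y = y * g y := by
  have hf' : ContDiff ℝ ∞ (deriv f) := (contDiff_infty_iff_deriv.1 hf).2
  refine ⟨fun y => ∫ t in (0 : ℝ)..1, deriv f (y * t),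
    contDiff_parametric_integral (F := fun p => deriv f (p.1 * p.2))
      (hf'.comp (contDiff_fst.mul contDiff_snd)), fun y => ?_⟩
  rw [intervalIntegral.mul_integral_comp_mul_left]
  rw [intervalIntegral.integral_deriv_eq_sub]
  · simp [h0]
  · exact fun x _ => hf.differentiable (by simp) x
  · exact hf'.continuous.intervalIntegrable _ _

lemma contDiff_iteratedDeriv {f : ℝ → ℝ} (hf : ContDiff ℝ ∞ f) (n : ℕ) :
    ContDiff ℝ ∞ (iteratedDeriv n f) := by
  induction n with
  | zero => simpa using hf
  | succ n ih =>
    rw [iteratedDeriv_succ]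
    exact (contDiff_infty_iff_deriv.1 ih).2

lemma iteratedDeriv_succ_id_mul {g : ℝ → ℝ} (hg : ContDiff ℝ ∞ g) (n : ℕ) :
    iteratedDeriv (n + 1) (fun y => y * g y) =
      fun y => y * iteratedDeriv (n + 1) g y + (n + 1) * iteratedDeriv n g y := by
  have hd : ∀ m y, HasDerivAt (iteratedDeriv m g) (iteratedDeriv (m + 1) g y) y := by
    intro m y
    rw [iteratedDeriv_succ]
    exact ((contDiff_iteratedDeriv hg m).differentiable (by simp) y).hasDerivAt
  induction n with
  | zero =>
    ext y
    have := (hasDerivAt_id y).mul (hd 0 y)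
    simp only [iteratedDeriv_zero, zero_add] at this ⊢
    rw [iteratedDeriv_one]
    refine (HasDerivAt.deriv this).trans ?_
    simp [add_comm]
  | succ n ih =>
    rw [iteratedDeriv_succ, ih]
    ext y
    have := ((hasDerivAt_id y).mul (hd (n + 1) y)).add ((hd n y).const_mul ((n : ℝ) + 1))
    refine (HasDerivAt.deriv this).trans ?_
    simp only [id]
    push_cast
    ring

lemma iteratedDeriv_succ_id_mul_zero {g : ℝ → ℝ} (hg : ContDiff ℝ ∞ g) (n : ℕ) :
    iteratedDeriv (n + 1) (fun y => y * g y) 0 = (n + 1) * iteratedDeriv n g 0 := by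
  simp [iteratedDeriv_succ_id_mul hg]

lemma iteratedDeriv_pow_mul_zero {g : ℝ → ℝ} (hg : ContDiff ℝ ∞ g) (k : ℕ) :
    iteratedDeriv k (fun y => y ^ k * g y) 0 = (k.factorial : ℝ) * g 0 := by
  induction k with
  | zero => simp
  | succ k ih =>
    have : (fun y : ℝ => y ^ (k + 1) * g y) = fun y => y * (y ^ k * g y) := by
      ext y; ring
    rw [this, iteratedDeriv_succ_id_mul_zero (by fun_prop), ih,
      Nat.factorial_succ]
    push_cast
    ring

lemma exists_eq_pow_mul {k : ℕ} : ∀ {f : ℝ → ℝ}, ContDiff ℝ ∞ f →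
    (∀ j < k, iteratedDeriv j f 0 = 0) →
    ∃ g : ℝ → ℝ, ContDiff ℝ ∞ g ∧ ∀ y, f y = y ^ k * g y := by
  induction k with
  | zero => exact fun {f} hf _ => ⟨f, hf, fun y => by simp⟩
  | succ k ih =>
    intro f hf h
    obtain ⟨g, hg, hfg⟩ := exists_eq_id_mul hf (by simpa using h 0 (by lia))
    obtain ⟨u, hu, hgu⟩ := ih hg fun j hj => by
      have := h (j + 1) (by lia)
      rw [funext hfg, iteratedDeriv_succ_id_mul_zero hg] at this
      exact (mul_eq_zero.1 this).resolve_left (by positivity)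
    exact ⟨u, hu, fun y => by rw [hfg, hgu]; ring⟩

/-- The Euler equation `y S' - m S = e` has a smooth solution as soon as the coefficient of
`y ^ m` in the Taylor expansion of `e` at `0` vanishes: this is the only resonance. -/
lemma exists_euler_solution (m : ℕ) : ∀ {e : ℝ → ℝ}, ContDiff ℝ ∞ e →
    iteratedDeriv m e 0 = 0 → e 0 = 0 →
    ∃ S : ℝ → ℝ, ContDiff ℝ ∞ S ∧ S 0 = 0 ∧ ∀ y, y * deriv S y - m * S y = e y := by
  suffices H : ∀ {e : ℝ → ℝ}, ContDiff ℝ ∞ e → iteratedDeriv m e 0 = 0 →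
      ∃ S : ℝ → ℝ, ContDiff ℝ ∞ S ∧ (m = 0 → S 0 = 0) ∧ ∀ y, y * deriv S y - m * S y = e y by
    intro e he hm h0
    obtain ⟨S, hS, hS0, h⟩ := H he hm
    refine ⟨S, hS, ?_, h⟩
    by_cases hm0 : m = 0
    · exact hS0 hm0
    · simpa [h0, hm0] using h 0
  induction m with
  | zero =>
    intro e he hm
    obtain ⟨g, hg, heg⟩ := exists_eq_id_mul he (by simpa using hm)
    obtain ⟨S, hS, hS0, h⟩ := exists_antideriv hg
    exact ⟨S, hS, fun _ => hS0, fun y => by simp [(h y).deriv, heg]⟩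
  | succ m ih =>
    intro e he hm
    obtain ⟨g, hg, heg⟩ := exists_eq_id_mul (f := fun y => e y - e 0) (by fun_prop) (by simp)
    have hg0 : iteratedDeriv m g 0 = 0 := by
      have h1 : e = fun y => e 0 + y * g y := by ext y; rw [← heg]; ring
      rw [h1, iteratedDeriv_succ', show deriv (fun y => e 0 + y * g y) = deriv fun y => y * g y
        from funext fun y => deriv_const_add _, ← iteratedDeriv_succ',
        iteratedDeriv_succ_id_mul_zero hg] at hm
      exact (mul_eq_zero.1 hm).resolve_left (by positivity)
    obtain ⟨S, hS, -, h⟩ := ih hg hg0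
    refine ⟨fun y => -e 0 / (m + 1) + y * S y, by fun_prop, by simp, fun y => ?_⟩
    have hd : HasDerivAt (fun y => -e 0 / (m + 1) + y * S y) (S y + y * deriv S y) y := by
      have := ((hasDerivAt_id y).mul
        (hS.differentiable (by simp) y).hasDerivAt).const_add (-e 0 / (m + 1))
      simpa using this
    rw [hd.deriv]
    have h2 := heg y
    have h3 := h y
    have h4 : ((m : ℝ) + 1) ≠ 0 := by positivity
    push_cast
    field_simp
    linear_combination y * h3 - h2

/-! ### The inverse function theorem for smooth germs -/

lemma isLocalDiffeomorphAt_of_hasFDerivAt {E : Type*} [NormedAddCommGroup E] [NormedSpace ℝ E]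
    [CompleteSpace E] {f : E → E} {a : E} (hf : ∀ᶠ x in 𝓝 a, ContDiffAt ℝ ∞ f x)
    (f' : E ≃L[ℝ] E) (hf' : HasFDerivAt f (f' : E →L[ℝ] E) a) :
    IsLocalDiffeomorphAt 𝓘(ℝ, E) 𝓘(ℝ, E) ∞ f a := by
  have ha := hf.self_of_nhds
  have hinv : ∀ᶠ x in 𝓝 a, fderiv ℝ f x ∈ Set.range ((↑) : (E ≃L[ℝ] E) → E →L[ℝ] E) := by
    have hc : ContinuousAt (fderiv ℝ f) a :=
      (ha.fderiv_right (m := 0) (by simp)).continuousAt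
    refine hc.eventually ?_
    rw [hf'.fderiv]
    exact f'.nhds
  obtain ⟨V, hV, hVo, haV⟩ := mem_nhds_iff.1 (hf.and hinv)
  let e := (ha.toOpenPartialHomeomorph f hf' (by simp)).restrOpen V hVo
  have hsrc : e.source ⊆ V := fun x hx => hx.2
  refine ⟨⟨e.toPartialEquiv, e.open_source, e.open_target, ?_, ?_⟩, ?_, fun x _ => rfl⟩
  · rw [contMDiffOn_iff_contDiffOn]
    exact fun x hx => (hV (hsrc hx)).1.contDiffWithinAt
  · rw [contMDiffOn_iff_contDiffOn]
    intro y hy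
    obtain ⟨h1, g', h2⟩ := hV (hsrc (e.map_target hy))
    refine (e.contDiffAt_symm (f₀' := g') hy ?_ h1).contDiffWithinAt
    rw [h2]
    exact (h1.differentiableAt (by simp)).hasFDerivAt
  · exact ⟨ha.mem_toOpenPartialHomeomorph_source hf' (by simp), haV⟩

/-! ### Conjugacy of vector fields on the line -/

lemma hasDerivAt_parametric_integral {F F' : ℝ → ℝ → ℝ} (hF : Continuous F.uncurry)
    (hF' : Continuous F'.uncurry) (hd : ∀ z s, HasDerivAt (fun z => F z s) (F' z s) z)
    (a b z₀ : ℝ) :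
    HasDerivAt (fun z => ∫ s in a..b, F z s) (∫ s in a..b, F' z₀ s) z₀ := by
  have hc : ∀ z, Continuous (F z) := fun z => hF.comp (Continuous.prodMk_right z)
  have hc' : ∀ z, Continuous (F' z) := fun z => hF'.comp (Continuous.prodMk_right z)
  obtain ⟨C, hC⟩ := ((isCompact_closedBall z₀ 1).prod
    (isCompact_uIcc (a := a) (b := b))).exists_bound_of_continuousOn hF'.continuousOn
  refine (intervalIntegral.hasDerivAt_integral_of_dominated_loc_of_deriv_le
    (F := F) (F' := F') (bound := fun _ => C)
    (Metric.closedBall_mem_nhds z₀ one_pos) (Eventually.of_forall fun z => ?_) ?_ ?_ ?_ ?_ ?_).2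
  · exact (hc z).aestronglyMeasurable
  · exact (hc z₀).intervalIntegrable _ _
  · exact (hc' z₀).aestronglyMeasurable
  · exact Eventually.of_forall fun s hs z hz => hC (z, s) ⟨hz, Set.uIoc_subset_uIcc hs⟩
  · exact intervalIntegrable_const
  · exact Eventually.of_forall fun s _ z _ => hd z s

/-- The function `G (z, w) = ∫ s in 1..w, n (z s) / s ^ k`, through which the flow time from `z` to
`z w` along the vector field `t ^ k / n t` is `z ^ (1 - k) * G (z, w)`. The last clause is the
homogeneity relation obtained by integrating `d/ds (n (z s) * s ^ (1 - k))`. -/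
lemma exists_scaled_time (k : ℕ) {n : ℝ → ℝ} (hn : ContDiff ℝ ∞ n) :
    ∃ G : ℝ × ℝ → ℝ, ContDiff ℝ ∞ G ∧ (∀ z, G (z, 1) = 0) ∧ ∀ᶠ w in 𝓝 (1 : ℝ), ∀ z,
      fderiv ℝ G (z, w) (0, 1) * w ^ k = n (z * w) ∧
      z * fderiv ℝ G (z, w) (1, 0) =
        fderiv ℝ G (z, w) (0, 1) * w - n z + ((k : ℝ) - 1) * G (z, w) := by
  -- A globally smooth function that agrees with `s ^ (-k)` near `1`.
  obtain ⟨κ, hκ, hκ1⟩ := exists_contDiff_eventuallyEq (f := fun s : ℝ => (s ^ k)⁻¹) (a := 1) (by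
    filter_upwards [lt_mem_nhds (zero_lt_one' ℝ)] with s hs
    exact (contDiffAt_id.pow k).inv (pow_pos hs k).ne')
  obtain ⟨ε, hε, hball⟩ := Metric.eventually_nhds_iff_ball.1
    (hκ1.and (lt_mem_nhds (zero_lt_one' ℝ)))
  have hκs : ∀ s ∈ Metric.ball (1 : ℝ) ε, κ s * s ^ k = 1 := fun s hs => by
    rw [(hball s hs).1]
    exact inv_mul_cancel₀ (pow_pos (hball s hs).2 k).ne'
  have hκd : ∀ s ∈ Metric.ball (1 : ℝ) ε, s * deriv κ s = -(k * κ s) := fun s hs => by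
    have hs0 := (hball s hs).2
    have h1 : HasDerivAt (fun s => κ s * s ^ k) (deriv κ s * s ^ k + κ s * (k * s ^ (k - 1))) s :=
      (hκ.differentiable (by simp) s).hasDerivAt.mul (hasDerivAt_pow k s)
    have h2 : HasDerivAt (fun s => κ s * s ^ k) 0 s := by
      refine (hasDerivAt_const s (1 : ℝ)).congr_of_eventuallyEq ?_
      filter_upwards [Metric.isOpen_ball.mem_nhds hs] with x hx using hκs x hx
    have h3 := h1.unique h2
    have h4 : (k : ℝ) * s ^ (k - 1) * s = k * s ^ k := by
      cases k with
      | zero => simp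
      | succ k => rw [Nat.add_sub_cancel]; ring
    refine mul_right_cancel₀ (pow_pos hs0 k).ne' ?_
    linear_combination s * h3 - κ s * h4
  let G : ℝ × ℝ → ℝ := fun q => ∫ s in (1 : ℝ)..q.2, n (q.1 * s) * κ s
  have hG : ContDiff ℝ ∞ G := by
    have : G = fun q => (q.2 - 1) * ∫ t in (0 : ℝ)..1,
        n (q.1 * ((q.2 - 1) * t + 1)) * κ ((q.2 - 1) * t + 1) := by
      ext q
      rw [intervalIntegral.mul_integral_comp_mul_add (f := fun s => n (q.1 * s) * κ s)]
      simp [G]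
    rw [this]
    refine (contDiff_snd.sub contDiff_const).mul (contDiff_parametric_integral
      (F := fun r : (ℝ × ℝ) × ℝ => n (r.1.1 * ((r.1.2 - 1) * r.2 + 1)) *
        κ ((r.1.2 - 1) * r.2 + 1)) ?_)
    fun_prop
  have hGd : ∀ q, HasFDerivAt G (fderiv ℝ G q) q := fun q =>
    (hG.differentiable (by simp) q).hasFDerivAt
  have hGw : ∀ z w, fderiv ℝ G (z, w) (0, 1) = n (z * w) * κ w := fun z w => by
    have hc : Continuous fun s => n (z * s) * κ s :=
      (hn.continuous.comp (continuous_const.mul continuous_id)).mul hκ.continuous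
    exact ((hGd (z, w)).comp_hasDerivAt w ((hasDerivAt_const w z).prodMk (hasDerivAt_id w))).unique
      (hc.integral_hasStrictDerivAt 1 w).hasDerivAt
  have hn' : Continuous (deriv n) := (contDiff_infty_iff_deriv.1 hn).2.continuous
  have hnd : ∀ t, HasDerivAt n (deriv n t) t := fun t => (hn.differentiable (by simp) t).hasDerivAt
  have hκc := hκ.continuous
  have hnc := hn.continuous
  have hGz : ∀ z w, fderiv ℝ G (z, w) (1, 0) =
      ∫ s in (1 : ℝ)..w, deriv n (z * s) * s * κ s := fun z w => by
    have h := hasDerivAt_parametric_integral (F := fun z s => n (z * s) * κ s)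
      (F' := fun z s => deriv n (z * s) * s * κ s)
      (by simp only [Function.uncurry_def]; fun_prop)
      (by simp only [Function.uncurry_def]; fun_prop)
      (fun z s => by
        have := ((hnd (z * s)).comp z ((hasDerivAt_id z).mul_const s)).mul_const (κ s)
        simpa using this) 1 w z
    have h' : HasDerivAt (fun z => G (z, w)) (fderiv ℝ G (z, w) (1, 0)) z :=
      HasFDerivAt.comp_hasDerivAt (l := G) (f := fun z => (z, w)) z (hGd (z, w))
        ((hasDerivAt_id z).prodMk (hasDerivAt_const z w))
    exact h'.unique h
  refine ⟨G, hG, fun z => by simp [G], ?_⟩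
  filter_upwards [Metric.ball_mem_nhds (1 : ℝ) hε] with w hw z
  refine ⟨by rw [hGw, mul_assoc, hκs w hw, mul_one], ?_⟩
  have hseg : Set.uIcc 1 w ⊆ Metric.ball (1 : ℝ) ε := by
    rw [← segment_eq_uIcc]
    exact (convex_ball (1 : ℝ) ε).segment_subset (Metric.mem_ball_self hε) hw
  have hFTC : ∫ s in (1 : ℝ)..w,
      (z * (deriv n (z * s) * s * κ s) - ((k : ℝ) - 1) * (n (z * s) * κ s)) =
      n (z * w) * (w * κ w) - n (z * 1) * (1 * κ 1) := by
    refine intervalIntegral.integral_eq_sub_of_hasDerivAt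
      (f := fun s => n (z * s) * (s * κ s)) (fun s hs => ?_) ?_
    · have h := ((hnd (z * s)).comp s ((hasDerivAt_id s).const_mul z)).mul
        ((hasDerivAt_id s).mul (hκ.differentiable (by simp) s).hasDerivAt)
      refine h.congr_deriv ?_
      have := hκd s (hseg hs)
      simp only [id, Function.comp_apply, Pi.mul_apply]
      linear_combination n (z * s) * this
    · exact Continuous.intervalIntegrable (by fun_prop) _ _
  rw [intervalIntegral.integral_sub (Continuous.intervalIntegrable (by fun_prop) _ _)
    (Continuous.intervalIntegrable (by fun_prop) _ _), intervalIntegral.integral_const_mul,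
    intervalIntegral.integral_const_mul, ← hGz] at hFTC
  have h1 : κ 1 = 1 := by simpa using hκs 1 (Metric.mem_ball_self hε)
  rw [mul_one, h1] at hFTC
  rw [hGw]
  simp only [G]
  linear_combination hFTC

/-- The germs at `0` of the vector fields `m ∂_y` and `b ∂_y` on the line are conjugate by the germ
`q` of a smooth diffeomorphism fixing `0` and tangent to the identity there: `q_* m = b`. -/
def TangentConjugate (b m : ℝ → ℝ) : Prop :=
  ∃ q : ℝ → ℝ, (∀ᶠ y in 𝓝 0, ContDiffAt ℝ ∞ q y) ∧ q 0 = 0 ∧ deriv q 0 = 1 ∧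
    ∀ᶠ y in 𝓝 0, deriv q y * m y = b (q y)

/-- If `m = y ^ k / p` and `b = y ^ k / n`, a conjugacy `q y = y * w y` is obtained by comparing
flow times: `G (y, w y) = S y`, where `G` is the function of `exists_scaled_time`, and this
equation is solved for `w` by the inverse function theorem applied to `(z, w) ↦ (z, G (z, w))`. -/
lemma tangentConjugate_of_euler_solution {b m p n S : ℝ → ℝ} (k : ℕ) (hn : ContDiff ℝ ∞ n)
    (hn0 : n 0 ≠ 0) (hS : ContDiff ℝ ∞ S) (hS0 : S 0 = 0)
    (hE : ∀ y, y * deriv S y - ((k : ℝ) - 1) * S y = p y - n y)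
    (hp0 : p 0 ≠ 0) (hp : ContinuousAt p 0)
    (hm : ∀ᶠ y in 𝓝 0, m y * p y = y ^ k) (hb : ∀ᶠ y in 𝓝 0, b y * n y = y ^ k) :
    TangentConjugate b m := by
  obtain ⟨G, hG, hG1, hGd⟩ := exists_scaled_time k hn
  have hGD : ∀ q, HasFDerivAt G (fderiv ℝ G q) q := fun q =>
    (hG.differentiable (by simp) q).hasFDerivAt
  set α := fderiv ℝ G (0, 1) (1, 0)
  set β := fderiv ℝ G (0, 1) (0, 1) with hβ
  have hβ0 : β ≠ 0 := by
    have := (hGd.self_of_nhds 0).1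
    rw [one_pow, mul_one, zero_mul] at this
    rwa [hβ, this]
  let Ψ : ℝ × ℝ → ℝ × ℝ := fun q => (q.1, G q)
  have hΨ : ContDiff ℝ ∞ Ψ := contDiff_fst.prodMk hG
  let A : (ℝ × ℝ) ≃L[ℝ] ℝ × ℝ := LinearEquiv.toContinuousLinearEquiv
    { toFun := fun v => (v.1, v.1 * α + v.2 * β)
      map_add' := fun u v => by ext <;> simp; ring
      map_smul' := fun c v => by ext <;> simp; ring
      invFun := fun v => (v.1, (v.2 - v.1 * α) / β)
      left_inv := fun v => by ext <;> simp [hβ0]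
      right_inv := fun v => by ext <;> simp [hβ0] }
  have hsplit : ∀ (L : ℝ × ℝ →L[ℝ] ℝ) (v : ℝ × ℝ), L v = v.1 * L (1, 0) + v.2 * L (0, 1) := by
    intro L v
    have : v = v.1 • (1, 0) + v.2 • (0, 1) := by ext <;> simp
    conv_lhs => rw [this]
    rw [map_add, map_smul, map_smul, smul_eq_mul, smul_eq_mul]
  have hA : HasFDerivAt Ψ (A : (ℝ × ℝ) →L[ℝ] ℝ × ℝ) (0, 1) := by
    refine (hasFDerivAt_fst.prodMk (hGD (0, 1))).congr_fderiv ?_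
    refine ContinuousLinearMap.ext fun v => ?_
    refine Prod.ext rfl ?_
    exact hsplit _ v
  have hloc := isLocalDiffeomorphAt_of_hasFDerivAt
    (Eventually.of_forall fun x => hΨ.contDiffAt) A hA
  have hΨ0 : Ψ (0, 1) = (0, 0) := by simp [Ψ, hG1]
  set Φ := hloc.localInverse
  let γ : ℝ → ℝ × ℝ := fun z => Φ (z, S z)
  have hγ0 : γ 0 = (0, 1) := by
    have := hloc.localInverse_left_inv hloc.localInverse_mem_target
    simpa [hΨ0, γ, hS0] using this
  have hcurve : ContDiff ℝ ∞ fun z => (z, S z) := contDiff_id.prodMk hS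
  have hsrc : ∀ᶠ z in 𝓝 (0 : ℝ), (z, S z) ∈ Φ.source := by
    refine hcurve.continuous.continuousAt.eventually (hloc.localInverse_open_source.mem_nhds ?_)
    have := hloc.localInverse_mem_source
    rw [hΨ0] at this
    simpa [hS0] using this
  have hγs : ∀ᶠ z in 𝓝 (0 : ℝ), ContDiffAt ℝ ∞ γ z := by
    filter_upwards [hsrc] with z hz
    have h1 := hloc.localInverse_contMDiffOn
    rw [contMDiffOn_iff_contDiffOn] at h1
    exact (h1.contDiffAt (hloc.localInverse_open_source.mem_nhds hz)).comp z hcurve.contDiffAt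
  have hγe : ∀ᶠ z in 𝓝 (0 : ℝ), γ z = (z, (γ z).2) ∧ G (z, (γ z).2) = S z := by
    filter_upwards [hsrc] with z hz
    have h1 := hloc.localInverse_right_inv hz
    have h2 : (γ z).1 = z := congrArg Prod.fst h1
    have h3 : γ z = (z, (γ z).2) := Prod.ext h2 rfl
    exact ⟨h3, by rw [← h3]; exact congrArg Prod.snd h1⟩
  let w : ℝ → ℝ := fun z => (γ z).2
  have hw0 : w 0 = 1 := by simp [w, hγ0]
  have hws : ∀ᶠ z in 𝓝 (0 : ℝ), ContDiffAt ℝ ∞ w z := by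
    filter_upwards [hγs] with z hz using contDiffAt_snd.comp z hz
  have hwd : ∀ᶠ z in 𝓝 (0 : ℝ), HasDerivAt w (deriv w z) z := by
    filter_upwards [hws] with z hz using (hz.differentiableAt (by simp)).hasDerivAt
  have hqd : ∀ᶠ z in 𝓝 (0 : ℝ), HasDerivAt (fun z => z * w z) (w z + z * deriv w z) z := by
    filter_upwards [hwd] with z hz
    exact ((hasDerivAt_id z).mul hz).congr_deriv (by simp)
  have hwc : ContinuousAt w 0 := hws.self_of_nhds.continuousAt
  have hqc : ContinuousAt (fun z => z * w z) 0 := continuousAt_id.mul hwc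
  refine ⟨fun z => z * w z, ?_, by simp, ?_, ?_⟩
  · filter_upwards [hws] with z hz using contDiffAt_id.mul hz
  · rw [hqd.self_of_nhds.deriv]
    simp [hw0]
  · have hwt : Tendsto w (𝓝 0) (𝓝 1) := by simpa [ContinuousAt, hw0] using hwc
    have hqt : Tendsto (fun z => z * w z) (𝓝 0) (𝓝 0) := by simpa [ContinuousAt] using hqc
    have hγe' := (hγe.mono fun z hz => hz.2).eventually_nhds
    filter_upwards [hwd, hqd, hγe', hwt.eventually hGd, hm, hqt.eventually hb,
      hp.eventually_ne hp0, hqt.eventually (hn.continuous.continuousAt.eventually_ne hn0)]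
      with z hwz hqz hGz hz hmz hbz hpz hnz
    rw [hqz.deriv]
    obtain ⟨h1, h2⟩ := hz z
    have hGS : G (z, w z) = S z := hGz.self_of_nhds
    have hder : fderiv ℝ G (z, w z) (1, deriv w z) = deriv S z := by
      have h4 : HasDerivAt (fun z => G (z, w z)) (fderiv ℝ G (z, w z) (1, deriv w z)) z :=
        (hGD (z, w z)).comp_hasDerivAt z ((hasDerivAt_id z).prodMk hwz)
      exact (h4.congr_of_eventuallyEq (EventuallyEq.symm hGz)).deriv.symm
    rw [hsplit] at hder
    simp only [one_mul] at hder
    set Gw := fderiv ℝ G (z, w z) (0, 1)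
    set Gz := fderiv ℝ G (z, w z) (1, 0)
    -- The equation `q' * n (q) = p * w ^ k`, which is the conjugacy relation without denominators.
    have hmain : (w z + z * deriv w z) * n (z * w z) = p z * w z ^ k := by
      have h5 : Gw * (w z + z * deriv w z) = p z := by
        linear_combination z * hder + hE z - h2 - ((k : ℝ) - 1) * hGS
      rw [← h1, ← h5]
      ring
    refine mul_right_cancel₀ (mul_ne_zero hpz hnz) ?_
    rw [mul_pow] at hbz
    linear_combination (w z + z * deriv w z) * n (z * w z) * hmz - p z * hbz + z ^ k * hmain

lemma tangentConjugate_of_iteratedDeriv_eq {b m p n : ℝ → ℝ} {k : ℕ} (hk : k ≠ 0)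
    (hp : ContDiff ℝ ∞ p) (hn : ContDiff ℝ ∞ n) (hn0 : n 0 ≠ 0) (hpn : p 0 = n 0)
    (hres : iteratedDeriv (k - 1) p 0 = iteratedDeriv (k - 1) n 0)
    (hm : ∀ᶠ y in 𝓝 0, m y * p y = y ^ k) (hb : ∀ᶠ y in 𝓝 0, b y * n y = y ^ k) :
    TangentConjugate b m := by
  obtain ⟨S, hS, hS0, hE⟩ := exists_euler_solution (k - 1) (e := p - n) (hp.sub hn)
    (by rw [iteratedDeriv_sub (contDiff_infty.1 hp _).contDiffAt
      (contDiff_infty.1 hn _).contDiffAt, hres, sub_self])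
    (by simp [hpn])
  refine tangentConjugate_of_euler_solution k hn hn0 hS hS0 (fun y => ?_) (hpn ▸ hn0)
    hp.continuous.continuousAt hm hb
  have := hE y
  rwa [Nat.cast_sub (Nat.one_le_iff_ne_zero.2 hk), Nat.cast_one] at this

lemma exists_contDiff_mul_eq_one {g : ℝ → ℝ} (hg : ContDiff ℝ ∞ g) (h0 : g 0 ≠ 0) :
    ∃ n : ℝ → ℝ, ContDiff ℝ ∞ n ∧ ∀ᶠ y in 𝓝 0, g y * n y = 1 := by
  have hne := hg.continuous.continuousAt.eventually_ne h0
  obtain ⟨n, hn, hgn⟩ := exists_contDiff_eventuallyEq (f := fun y => (g y)⁻¹) (a := 0) (by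
    filter_upwards [hne] with y hy using hg.contDiffAt.inv hy)
  refine ⟨n, hn, ?_⟩
  filter_upwards [hgn, hne] with y hy hy0
  rw [hy, mul_inv_cancel₀ hy0]

lemma tangentConjugate_const {b : ℝ → ℝ} (hb : ContDiff ℝ ∞ b) (h0 : b 0 ≠ 0) :
    TangentConjugate b fun _ => b 0 := by
  obtain ⟨n, hn, hbn⟩ := exists_contDiff_mul_eq_one hb h0
  have hbn0 := hbn.self_of_nhds
  have hn0 : n 0 = (b 0)⁻¹ := eq_inv_of_mul_eq_one_right hbn0
  obtain ⟨E, hE, hE0, hEd⟩ := exists_antideriv (f := fun y => (b 0)⁻¹ - n y) (by fun_prop)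
  obtain ⟨S, hS, hES⟩ := exists_eq_id_mul hE hE0
  have hEq : ∀ y, S y + y * deriv S y = (b 0)⁻¹ - n y := fun y => by
    refine HasDerivAt.unique ?_ (hEd y)
    rw [funext hES]
    exact ((hasDerivAt_id y).mul (hS.differentiable (by simp) y).hasDerivAt).congr_deriv (by simp)
  refine tangentConjugate_of_euler_solution (p := fun _ => (b 0)⁻¹) 0 hn
    (by rw [hn0]; exact inv_ne_zero h0) hS (by simpa [hn0] using hEq 0) (fun y => ?_)
    (inv_ne_zero h0) continuousAt_const (Eventually.of_forall fun y => by simp [h0])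
    (by simpa using hbn)
  rw [← hEq]
  push_cast
  ring

lemma tangentConjugate_linear {b : ℝ → ℝ} (hb : ContDiff ℝ ∞ b) (h0 : b 0 = 0)
    (h1 : deriv b 0 ≠ 0) : TangentConjugate b fun y => deriv b 0 * y := by
  obtain ⟨g, hg, hbg⟩ := exists_eq_id_mul hb h0
  have ha : deriv b 0 = g 0 := by
    have := iteratedDeriv_succ_id_mul_zero hg 0
    simpa [← funext hbg] using this
  rw [ha] at h1 ⊢
  obtain ⟨n, hn, hgn⟩ := exists_contDiff_mul_eq_one hg h1
  have hn0 : n 0 = (g 0)⁻¹ := eq_inv_of_mul_eq_one_right hgn.self_of_nhds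
  refine tangentConjugate_of_iteratedDeriv_eq (p := fun _ => (g 0)⁻¹) one_ne_zero contDiff_const hn
    (by rw [hn0]; exact inv_ne_zero h1) hn0.symm (by simp [hn0])
    (Eventually.of_forall fun y => by field_simp) ?_
  filter_upwards [hgn] with y hy
  rw [hbg, mul_assoc, hy, pow_one, mul_one]

/-- The coefficient `d` is determined by the requirement that `1 / (a + d y ^ (k - 1))`, whose
coefficient of `y ^ (k - 1)` is `-d / a ^ 2`, agrees with `y ^ k / b` in that coefficient. -/
lemma exists_tangentConjugate_degenerate {b : ℝ → ℝ} (hb : ContDiff ℝ ∞ b) {k : ℕ} (hk : 2 ≤ k)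
    (hj : ∀ j < k, iteratedDeriv j b 0 = 0) (hbk : iteratedDeriv k b 0 ≠ 0) :
    ∃ a d : ℝ, a ≠ 0 ∧ TangentConjugate b fun y => a * y ^ k + d * y ^ (2 * k - 1) := by
  obtain ⟨g, hg, hbg⟩ := exists_eq_pow_mul hb hj
  have ha : g 0 ≠ 0 := by
    rw [funext hbg, iteratedDeriv_pow_mul_zero hg] at hbk
    exact right_ne_zero_of_mul hbk
  obtain ⟨n, hn, hgn⟩ := exists_contDiff_mul_eq_one hg ha
  have hn0 : n 0 = (g 0)⁻¹ := eq_inv_of_mul_eq_one_right hgn.self_of_nhds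
  set a := g 0
  set c := iteratedDeriv (k - 1) n 0 with hc
  have hfac : ((k - 1).factorial : ℝ) ≠ 0 := by positivity
  let d : ℝ := -(c * a ^ 2 / (k - 1).factorial)
  have hk1 : k - 1 ≠ 0 := by lia
  obtain ⟨p, hp, hpm⟩ := exists_contDiff_mul_eq_one (g := fun y => a + d * y ^ (k - 1))
    (by fun_prop) (by simpa [hk1] using ha)
  have hp0 : p 0 = a⁻¹ := by
    have := hpm.self_of_nhds
    simp only [zero_pow hk1, mul_zero, add_zero] at this
    exact eq_inv_of_mul_eq_one_right this
  have hpexp : p =ᶠ[𝓝 0] fun y => a⁻¹ + y ^ (k - 1) * (-(d / a) * p y) := by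
    filter_upwards [hpm] with y hy
    field_simp
    linear_combination hy
  have hpd : iteratedDeriv (k - 1) p 0 = c := by
    rw [hpexp.iteratedDeriv_eq, iteratedDeriv_const_add (by lia),
      iteratedDeriv_pow_mul_zero (by fun_prop), hp0]
    simp only [d]
    field_simp
  refine ⟨a, d, ha, tangentConjugate_of_iteratedDeriv_eq (by lia) hp hn
    (by rw [hn0]; exact inv_ne_zero ha) (by rw [hp0, hn0]) hpd ?_ ?_⟩
  · filter_upwards [hpm] with y hy
    rw [show 2 * k - 1 = k + (k - 1) by lia, pow_add]
    linear_combination y ^ k * hy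
  · filter_upwards [hgn] with y hy
    rw [hbg, mul_assoc, hy, mul_one]

/-! ### Vector fields preserving `μ` -/

/-- The vector field `-(1 + x) b'(y) ∂_x + b(y) ∂_y`, which preserves `μ`. -/
noncomputable def suspension (b : ℝ → ℝ) : Plane → Plane :=
  fun p => (-(1 + p.1) * deriv b p.2, b p.2)

lemma contDiff_suspension {b : ℝ → ℝ} (hb : ContDiff ℝ ∞ b) : ContDiff ℝ ∞ (suspension b) := by
  have hb' : ContDiff ℝ ∞ (deriv b) := (contDiff_infty_iff_deriv.1 hb).2
  exact ((contDiff_const.add contDiff_fst).neg.mul (hb'.comp contDiff_snd)).prodMk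
    (hb.comp contDiff_snd)

lemma fderiv_mu_apply (p w v : Plane) : fderiv ℝ mu p w v = w.1 * v.2 := by
  have h : HasFDerivAt mu ((ContinuousLinearMap.fst ℝ ℝ ℝ).smulRight
      (ContinuousLinearMap.snd ℝ ℝ ℝ)) p :=
    (hasFDerivAt_fst.const_add 1).smul_const (ContinuousLinearMap.snd ℝ ℝ ℝ)
  simp [h.fderiv]

/-- The components of `L_X μ = 0` are `(1 + x) ∂_x X₂ = 0` and `X₁ + (1 + x) ∂_y X₂ = 0`. -/
lemma PreservesMu.exists_eventuallyEq_suspension {X : Plane → Plane} (hX : PreservesMu X) :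
    ∃ b : ℝ → ℝ, ContDiff ℝ ∞ b ∧ X =ᶠ[𝓝 0] suspension b := by
  have h1x : ∀ᶠ p : Plane in 𝓝 0, 1 + p.1 ≠ 0 :=
    (continuous_const.add continuous_fst).continuousAt.eventually_ne (by simp)
  obtain ⟨ε, hε, h⟩ := Metric.eventually_nhds_iff_ball.1
    ((hX.smooth.and hX.lie_eq_zero).and h1x)
  set B := Metric.ball (0 : ℝ) ε
  have h0 : (0 : ℝ) ∈ B := Metric.mem_ball_self hε
  have hmem : ∀ x ∈ B, ∀ y ∈ B, ((x, y) : Plane) ∈ Metric.ball (0 : Plane) ε := by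
    intro x hx y hy
    rw [Prod.zero_eq_mk, ← ball_prod_same]
    exact ⟨hx, hy⟩
  have hlie : ∀ x ∈ B, ∀ y ∈ B, ∀ v : Plane,
      (X (x, y)).1 * v.2 + (1 + x) * (fderiv ℝ X (x, y) v).2 = 0 := by
    intro x hx y hy v
    have := congrArg (fun L : Plane →L[ℝ] ℝ => L v) (h _ (hmem x hx y hy)).1.2
    simpa [lieDerivative, fderiv_mu_apply, mu] using this
  have hd : ∀ x ∈ B, ∀ y ∈ B, HasFDerivAt X (fderiv ℝ X (x, y)) (x, y) := fun x hx y hy =>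
    ((h _ (hmem x hx y hy)).1.1.differentiableAt (by simp)).hasFDerivAt
  have hdx : ∀ x ∈ B, ∀ y ∈ B, HasDerivAt (fun s => (X (s, y)).2) 0 x := by
    intro x hx y hy
    have h1 := hlie x hx y hy (1, 0)
    simp only [mul_zero, zero_add] at h1
    rw [← (mul_eq_zero.1 h1).resolve_left (h _ (hmem x hx y hy)).2]
    exact (ContinuousLinearMap.snd ℝ ℝ ℝ).hasFDerivAt.comp_hasDerivAt x
      (HasFDerivAt.comp_hasDerivAt (l := X) (f := fun s => (s, y)) x (hd x hx y hy)
        ((hasDerivAt_id x).prodMk (hasDerivAt_const x y)))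
  let b₀ : ℝ → ℝ := fun y => (X (0, y)).2
  have hconst : ∀ x ∈ B, ∀ y ∈ B, (X (x, y)).2 = b₀ y := fun x hx y hy =>
    Metric.isOpen_ball.is_const_of_deriv_eq_zero (convex_ball (0 : ℝ) ε).isPreconnected
      (f := fun s => (X (s, y)).2)
      (fun s hs => (hdx s hs y hy).differentiableAt.differentiableWithinAt)
      (fun s hs => (hdx s hs y hy).deriv) hx h0
  have hdy : ∀ x ∈ B, ∀ y ∈ B, deriv b₀ y = (fderiv ℝ X (x, y) (0, 1)).2 := by
    intro x hx y hy
    have h1 : HasDerivAt (fun t => (X (x, t)).2) (fderiv ℝ X (x, y) (0, 1)).2 y :=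
      (ContinuousLinearMap.snd ℝ ℝ ℝ).hasFDerivAt.comp_hasDerivAt y
        (HasFDerivAt.comp_hasDerivAt (l := X) (f := fun t => (x, t)) y (hd x hx y hy)
          ((hasDerivAt_const y x).prodMk (hasDerivAt_id y)))
    refine (h1.congr_of_eventuallyEq ?_).deriv
    filter_upwards [Metric.isOpen_ball.mem_nhds hy] with t ht using (hconst x hx t ht).symm
  obtain ⟨b, hb, hbb⟩ := exists_contDiff_eventuallyEq (f := b₀) (a := 0) (by
    filter_upwards [Metric.isOpen_ball.mem_nhds h0] with y hy
    exact contDiffAt_snd.comp y ((h _ (hmem 0 h0 y hy)).1.1.comp y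
      (contDiffAt_const.prodMk contDiffAt_id)))
  refine ⟨b, hb, ?_⟩
  have hfst : Tendsto Prod.fst (𝓝 (0 : Plane)) (𝓝 0) := continuous_fst.tendsto 0
  have hsnd : Tendsto Prod.snd (𝓝 (0 : Plane)) (𝓝 0) := continuous_snd.tendsto 0
  filter_upwards [hfst.eventually (Metric.isOpen_ball.mem_nhds h0),
    hsnd.eventually (Metric.isOpen_ball.mem_nhds h0), hsnd.eventually hbb.eventually_nhds]
    with p hx hy hp
  refine Prod.ext ?_ ?_
  · have h1 := hlie p.1 hx p.2 hy (0, 1)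
    rw [← hdy p.1 hx p.2 hy, ← EventuallyEq.deriv_eq hp] at h1
    simp only [suspension]
    linear_combination h1
  · exact (hconst p.1 hx p.2 hy).trans hp.self_of_nhds.symm

/-! ### Diffeomorphisms preserving `μ` -/

/-- The map `(x, y) ↦ ((1 + x) / q'(y) - 1, q(y))`, which preserves `μ` where `q' ≠ 0`. -/
noncomputable def suspensionMap (q : ℝ → ℝ) : Plane → Plane :=
  fun p => ((1 + p.1) * (deriv q p.2)⁻¹ - 1, q p.2)

lemma contDiffAt_deriv {q : ℝ → ℝ} {y : ℝ} (hq : ContDiffAt ℝ ∞ q y) :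
    ContDiffAt ℝ ∞ (deriv q) y :=
  (hq.fderiv_right (m := ∞) (by simp)).clm_apply (contDiffAt_const (c := (1 : ℝ)))

lemma contDiffAt_suspensionMap {q : ℝ → ℝ} {p : Plane} (hq : ContDiffAt ℝ ∞ q p.2)
    (hq0 : deriv q p.2 ≠ 0) : ContDiffAt ℝ ∞ (suspensionMap q) p :=
  (((contDiffAt_const.add contDiffAt_fst).mul
    (((contDiffAt_deriv hq).inv hq0).comp p contDiffAt_snd)).sub contDiffAt_const).prodMk
    (hq.comp p contDiffAt_snd)

lemma hasFDerivAt_suspensionMap {q : ℝ → ℝ} {p : Plane} (hq : ContDiffAt ℝ ∞ q p.2)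
    (hq0 : deriv q p.2 ≠ 0) :
    HasFDerivAt (suspensionMap q)
      (((1 + p.1) • ((-deriv (deriv q) p.2 / deriv q p.2 ^ 2) • ContinuousLinearMap.snd ℝ ℝ ℝ) +
        (deriv q p.2)⁻¹ • ContinuousLinearMap.fst ℝ ℝ ℝ).prod
        (deriv q p.2 • ContinuousLinearMap.snd ℝ ℝ ℝ)) p := by
  have hq' : HasDerivAt (deriv q) (deriv (deriv q) p.2) p.2 :=
    ((contDiffAt_deriv hq).differentiableAt (by simp)).hasDerivAt
  have h1 : HasFDerivAt (fun p : Plane => (deriv q p.2)⁻¹)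
      ((-deriv (deriv q) p.2 / deriv q p.2 ^ 2) • ContinuousLinearMap.snd ℝ ℝ ℝ) p :=
    (hq'.inv hq0).comp_hasFDerivAt p hasFDerivAt_snd
  have h2 : HasFDerivAt (fun p : Plane => q p.2)
      (deriv q p.2 • ContinuousLinearMap.snd ℝ ℝ ℝ) p :=
    (hq.differentiableAt (by simp)).hasDerivAt.comp_hasFDerivAt p hasFDerivAt_snd
  exact (((hasFDerivAt_fst.const_add 1).mul h1).sub_const 1).prodMk h2

lemma isMuDiffeo_suspensionMap {q : ℝ → ℝ} (hq : ∀ᶠ y in 𝓝 0, ContDiffAt ℝ ∞ q y)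
    (hq0 : q 0 = 0) (hq1 : deriv q 0 = 1) : IsMuDiffeo (suspensionMap q) := by
  have hne : ∀ᶠ y in 𝓝 0, deriv q y ≠ 0 :=
    (contDiffAt_deriv hq.self_of_nhds).continuousAt.eventually_ne (by simp [hq1])
  have hev : ∀ᶠ p : Plane in 𝓝 0, ContDiffAt ℝ ∞ q p.2 ∧ deriv q p.2 ≠ 0 :=
    (continuous_snd.tendsto (0 : Plane)).eventually (hq.and hne)
  refine ⟨by simp [suspensionMap, hq0, hq1], ?_, ?_⟩
  · let c := -deriv (deriv q) 0
    let A : Plane ≃L[ℝ] Plane := LinearEquiv.toContinuousLinearEquiv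
      { toFun := fun v => (c * v.2 + v.1, v.2)
        map_add' := fun u v => by ext <;> simp; ring
        map_smul' := fun r v => by ext <;> simp; ring
        invFun := fun v => (v.1 - c * v.2, v.2)
        left_inv := fun v => by ext <;> simp
        right_inv := fun v => by ext <;> simp }
    refine isLocalDiffeomorphAt_of_hasFDerivAt
      (hev.mono fun p hp => contDiffAt_suspensionMap hp.1 hp.2) A ?_
    refine (hasFDerivAt_suspensionMap hev.self_of_nhds.1 hev.self_of_nhds.2).congr_fderiv ?_
    refine ContinuousLinearMap.ext fun v => Prod.ext ?_ ?_
    · simp [hq1, A, c]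
    · simp [hq1, A]
  · filter_upwards [hev] with p hp
    refine ContinuousLinearMap.ext fun v => ?_
    rw [pullback, (hasFDerivAt_suspensionMap hp.1 hp.2).fderiv]
    have := hp.2
    simp only [mu, suspensionMap, ContinuousLinearMap.comp_apply, ContinuousLinearMap.prod_apply,
      FunLike.coe_smul, Pi.smul_apply, ContinuousLinearMap.coe_snd', smul_eq_mul]
    field_simp
    ring

/-- A conjugacy on the line lifts to the plane: differentiating `q' * m = b ∘ q` gives the
first component of the conjugacy relation. -/
lemma TangentConjugate.muConjugate {X : Plane → Plane} {b m : ℝ → ℝ} (hb : ContDiff ℝ ∞ b)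
    (hm : ContDiff ℝ ∞ m) (hX : X =ᶠ[𝓝 0] suspension b) (h : TangentConjugate b m) :
    MuConjugate X (suspension m) := by
  obtain ⟨q, hq, hq0, hq1, hqm⟩ := h
  have hφ := isMuDiffeo_suspensionMap hq hq0 hq1
  have hne : ∀ᶠ y in 𝓝 0, deriv q y ≠ 0 :=
    (contDiffAt_deriv hq.self_of_nhds).continuousAt.eventually_ne (by simp [hq1])
  have hφt : Tendsto (suspensionMap q) (𝓝 0) (𝓝 0) := by
    have := hφ.diffeo.contMDiffAt.continuousAt
    rwa [ContinuousAt, hφ.map_zero] at this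
  refine ⟨suspensionMap q, hφ, ?_⟩
  filter_upwards [hφt.eventually hX, (continuous_snd.tendsto (0 : Plane)).eventually
    ((hq.and hne).and hqm.eventually_nhds)] with p hp h
  obtain ⟨⟨hqs, hqn⟩, hqe⟩ := h
  have hbd : HasDerivAt b (deriv b (q p.2)) (q p.2) :=
    (hb.differentiable (by simp) _).hasDerivAt
  have hmd : HasDerivAt m (deriv m p.2) p.2 := (hm.differentiable (by simp) _).hasDerivAt
  have hqd : HasDerivAt q (deriv q p.2) p.2 := (hqs.differentiableAt (by simp)).hasDerivAt
  have hqd' : HasDerivAt (deriv q) (deriv (deriv q) p.2) p.2 :=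
    ((contDiffAt_deriv hqs).differentiableAt (by simp)).hasDerivAt
  have hder : deriv (deriv q) p.2 * m p.2 + deriv q p.2 * deriv m p.2 =
      deriv b (q p.2) * deriv q p.2 :=
    (hqd'.mul hmd).unique ((hbd.comp p.2 hqd).congr_of_eventuallyEq hqe)
  rw [hp, (hasFDerivAt_suspensionMap hqs hqn).fderiv]
  refine Prod.ext ?_ ?_
  · simp only [suspension, suspensionMap, ContinuousLinearMap.prod_apply, add_apply,
      FunLike.coe_smul, Pi.smul_apply, ContinuousLinearMap.coe_snd',
      ContinuousLinearMap.coe_fst', smul_eq_mul]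
    field_simp
    linear_combination -(1 + p.1) * hder
  · simpa [suspension, suspensionMap] using hqe.self_of_nhds

/-- The value at the origin of the `∂_y`-component is an invariant, because `μ` is `dy` there. -/
lemma MuConjugate.snd_zero_eq {X Y : Plane → Plane} (h : MuConjugate X Y) :
    (X 0).2 = (Y 0).2 := by
  obtain ⟨φ, hφ, hc⟩ := h
  have h1 := hc.self_of_nhds
  have h2 := congrArg (fun L : Plane →L[ℝ] ℝ => L (Y 0)) hφ.pullback_eq.self_of_nhds
  rw [hφ.map_zero] at h1
  rw [← h1]
  simpa [pullback, mu, hφ.map_zero] using h2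

/-! ### Jets and hyperbolicity -/

lemma iteratedDeriv_eq_zero_of_jetVanishes {X : Plane → Plane} {b : ℝ → ℝ} {i : ℕ}
    (hb : ContDiff ℝ ∞ b) (hX : X =ᶠ[𝓝 0] suspension b) (h : JetVanishes i X) {j : ℕ}
    (hj : j ≤ i + 1) : iteratedDeriv j b 0 = 0 := by
  -- The components of the restriction of the vector field to the line `x = 0`.
  have key : ∀ m ≤ i, ∀ L : Plane →L[ℝ] ℝ,
      iteratedDeriv m (fun y => L (suspension b (0, y))) 0 = 0 := by
    intro m hm L
    have hs := contDiff_suspension hb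
    have h1 : iteratedFDeriv ℝ m (suspension b) 0 = 0 := by
      rw [← h m hm]
      exact (hX.symm.iteratedFDeriv ℝ m).self_of_nhds
    have h2 := (ContinuousLinearMap.inr ℝ ℝ ℝ).iteratedFDeriv_comp_right
      (L.contDiff.comp hs) 0 (i := m) (by exact_mod_cast le_top)
    rw [map_zero, L.iteratedFDeriv_comp_left hs.contDiffAt (by exact_mod_cast le_top), h1] at h2
    rw [← norm_eq_zero, ← norm_iteratedFDeriv_eq_norm_iteratedDeriv, norm_eq_zero]
    refine Eq.trans h2 ?_
    ext
    simp
  cases j with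
  | zero => simpa [suspension] using key 0 (by lia) (ContinuousLinearMap.snd ℝ ℝ ℝ)
  | succ j =>
    have := key j (by lia) (-ContinuousLinearMap.fst ℝ ℝ ℝ)
    rw [iteratedDeriv_succ']
    simpa [suspension] using this

lemma jetVanishes_of_iteratedDeriv_eq_zero {X : Plane → Plane} {b : ℝ → ℝ} {i : ℕ}
    (hb : ContDiff ℝ ∞ b) (hX : X =ᶠ[𝓝 0] suspension b)
    (h : ∀ j ≤ i + 1, iteratedDeriv j b 0 = 0) : JetVanishes i X := by
  have hb' : ContDiff ℝ ∞ (deriv b) := (contDiff_infty_iff_deriv.1 hb).2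
  have hsnd : ∀ {f : ℝ → ℝ}, ContDiff ℝ ∞ f → ∀ m, iteratedDeriv m f 0 = 0 →
      iteratedFDeriv ℝ m (fun p : Plane => f p.2) 0 = 0 := by
    intro f hf m hm
    refine ((ContinuousLinearMap.snd ℝ ℝ ℝ).iteratedFDeriv_comp_right hf 0 (i := m)
      (by exact_mod_cast le_top)).trans ?_
    rw [← norm_eq_zero, ← norm_iteratedFDeriv_eq_norm_iteratedDeriv, norm_eq_zero] at hm
    rw [map_zero, hm]
    ext
    simp
  intro m hm
  have h1 : iteratedFDeriv ℝ m (fun p : Plane => -(1 + p.1) * deriv b p.2) 0 = 0 := by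
    rw [← norm_le_zero_iff]
    refine (norm_iteratedFDeriv_mul_le (N := ∞) (f := fun p : Plane => -(1 + p.1))
      (g := fun p => deriv b p.2) (by fun_prop) (hb'.comp contDiff_snd) 0
      (n := m) (by exact_mod_cast le_top)).trans (Finset.sum_nonpos fun l _ => ?_)
    rw [hsnd hb' (m - l) (by rw [← iteratedDeriv_succ']; exact h _ (by lia)), norm_zero, mul_zero]
  have h2 := hsnd hb m (h m (by lia))
  rw [(hX.iteratedFDeriv ℝ m).self_of_nhds]
  have hs := contDiff_suspension hb
  have hcomp : ∀ L : Plane →L[ℝ] ℝ, iteratedFDeriv ℝ m (L ∘ suspension b) 0 = 0 →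
      ∀ v, L (iteratedFDeriv ℝ m (suspension b) 0 v) = 0 := by
    intro L hL v
    rw [L.iteratedFDeriv_comp_left hs.contDiffAt (by exact_mod_cast le_top)] at hL
    exact congrArg (fun T => T v) hL
  refine ContinuousMultilinearMap.ext fun v => Prod.ext ?_ ?_
  · exact hcomp (ContinuousLinearMap.fst ℝ ℝ ℝ) h1 v
  · exact hcomp (ContinuousLinearMap.snd ℝ ℝ ℝ) h2 v

lemma not_isHyperbolicSingularity {X : Plane → Plane} {b : ℝ → ℝ} {p : Plane}
    (hb : ContDiff ℝ ∞ b) (hX : X =ᶠ[𝓝 p] suspension b) (hp : 1 + p.1 ≠ 0) :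
    ¬ IsHyperbolicSingularity X p := by
  rintro ⟨h0, h⟩
  rw [hX.self_of_nhds] at h0
  have h1 : deriv b p.2 = 0 := by
    have := congrArg Prod.fst h0
    exact (mul_eq_zero.1 this).resolve_left (neg_ne_zero.2 hp)
  have hs : HasFDerivAt X (fderiv ℝ X p) p :=
    (((contDiff_suspension hb).differentiable (by simp) p).congr_of_eventuallyEq hX).hasFDerivAt
  have hker : fderiv ℝ X p (1, 0) = 0 := by
    have h2 : HasDerivAt (fun x => X (x, p.2)) (fderiv ℝ X p (1, 0)) p.1 :=
      HasFDerivAt.comp_hasDerivAt (l := X) (f := fun x => (x, p.2)) p.1 hs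
        ((hasDerivAt_id p.1).prodMk (hasDerivAt_const p.1 p.2))
    refine h2.unique ((hasDerivAt_const p.1 ((0, b p.2) : Plane)).congr_of_eventuallyEq ?_)
    have : Tendsto (fun x => (x, p.2)) (𝓝 p.1) (𝓝 p) :=
      (Continuous.prodMk_left p.2).tendsto p.1
    filter_upwards [this.eventually hX] with x hx
    simp [hx, suspension, h1]
  refine h 0 ?_ rfl
  refine Module.End.hasEigenvalue_of_hasEigenvector (x := (1 : ℂ) ⊗ₜ[ℝ] ((1, 0) : Plane)) ?_
  rw [Module.End.hasEigenvector_iff]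
  refine ⟨?_, ?_⟩
  · rw [Module.End.mem_eigenspace_iff]
    simp [hker]
  · intro h2
    have h3 := congrArg (TensorProduct.rid ℝ ℂ ∘ LinearMap.lTensor ℂ (LinearMap.fst ℝ ℝ ℝ)) h2
    simp at h3

end Martinet

theorem mainTheorem1 (X : Martinet.Plane → Martinet.Plane) (hX : Martinet.PreservesMu X) :
    (∀ᶠ p in 𝓝 (0 : Martinet.Plane), ¬ Martinet.IsHyperbolicSingularity X p) ∧
    (X 0 ≠ 0 →
      Xor (∃ a : ℝ, a ≠ 0 ∧ Martinet.MuConjugate X (Martinet.modelZero a))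
        (∃ a : ℝ, a ≠ 0 ∧ Martinet.MuConjugate X (Martinet.modelOne a))) ∧
    (∀ k : ℕ, 2 ≤ k →
      (∀ i : ℕ, i ≤ k - 2 → Martinet.JetVanishes i X) →
      ¬ Martinet.JetVanishes (k - 1) X →
      ∃ a d : ℝ, a ≠ 0 ∧ Martinet.MuConjugate X (Martinet.modelDegenerate k a d)) := by
  obtain ⟨b, hb, hXb⟩ := hX.exists_eventuallyEq_suspension
  have hX0 : X 0 = (-deriv b 0, b 0) := by simp [hXb.self_of_nhds, Martinet.suspension]
  refine ⟨?_, fun h0 => ?_, fun k hk hvan hjet => ?_⟩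
  · have h1x : ∀ᶠ p : Martinet.Plane in 𝓝 0, 1 + p.1 ≠ 0 :=
      (continuous_const.add continuous_fst).continuousAt.eventually_ne (by simp)
    filter_upwards [hXb.eventually_nhds, h1x] with p hp h1
    exact Martinet.not_isHyperbolicSingularity hb hp h1
  · by_cases hb0 : b 0 = 0
    · have hb1 : deriv b 0 ≠ 0 := fun h => h0 (by rw [hX0, hb0, h]; simp)
      refine Or.inr ⟨⟨deriv b 0, hb1, ?_⟩, ?_⟩
      · have h := (Martinet.tangentConjugate_linear hb hb0 hb1).muConjugate hb (by fun_prop) hXb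
        convert h using 1
        ext p
        · simp [Martinet.modelOne, Martinet.suspension]
          ring
        · rfl
      · rintro ⟨a, ha, hc⟩
        have h := hc.snd_zero_eq
        rw [hX0] at h
        exact ha (h.symm.trans hb0)
    · refine Or.inl ⟨⟨b 0, hb0, ?_⟩, ?_⟩
      · have h := (Martinet.tangentConjugate_const hb hb0).muConjugate hb contDiff_const hXb
        convert h using 1
        ext p <;> simp [Martinet.modelZero, Martinet.suspension]
      · rintro ⟨a, ha, hc⟩
        have h := hc.snd_zero_eq
        rw [hX0] at h
        exact hb0 (by simpa [Martinet.modelOne] using h)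
  · have hlow : ∀ j < k, iteratedDeriv j b 0 = 0 := fun j hj =>
      Martinet.iteratedDeriv_eq_zero_of_jetVanishes hb hXb (hvan (k - 2) le_rfl) (by lia)
    have hbk : iteratedDeriv k b 0 ≠ 0 := fun h =>
      hjet (Martinet.jetVanishes_of_iteratedDeriv_eq_zero hb hXb fun j hj => by
        rcases (show j ≤ k by lia).lt_or_eq with h' | rfl
        exacts [hlow j h', h])
    obtain ⟨a, d, ha, hc⟩ := Martinet.exists_tangentConjugate_degenerate hb hk hlow hbk
    refine ⟨a, d, ha, ?_⟩
    have h := hc.muConjugate hb (by fun_prop) hXb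
    convert h using 1
    ext p
    · have hd : HasDerivAt (fun y : ℝ => a * y ^ k + d * y ^ (2 * k - 1))
          (a * (k * p.2 ^ (k - 1)) + d * ((2 * k - 1 : ℕ) * p.2 ^ (2 * k - 1 - 1))) p.2 :=
        ((hasDerivAt_pow k p.2).const_mul a).add ((hasDerivAt_pow (2 * k - 1) p.2).const_mul d)
      simp only [Martinet.modelDegenerate, Martinet.suspension]
      rw [hd.deriv, show 2 * k - 1 - 1 = 2 * k - 2 by lia, Nat.cast_sub (by lia)]
      push_cast
      ring
    · rfl
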